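/- Let $n\ge 2$ and $\Lambda\ge 0$. There exist constants $\delta>0$ and $\mathcal K>0$, depending only on $n$ and $\Lambda$, with the following property. Let $0<s<1$, let $\Omega\subset\mathbb R^n$ be a bounded Lipschitz domain, let $c,g\in L^\infty(\Omega)$ with $\|c\|_{L^\infty(\Omega)}\le\Lambda$, and let $u:\mathbb R^n\to\mathbb R$ satisfy $u\in L^1_{\mathrm{loc}}(\mathbb R^n)$, $\int_{\mathbb R^n}\frac{|u(y)|}{(1+|y|)^{n+2s}}\,dy<\infty$ and $u|_{\overline\Omega}\in C^1(\overline\Omega)$. Suppose that $u$ is a weak subsolution of $-\Delta u+(-\Delta)^s u+c(x)u=g$ in $\Omega$, that is, $$\int_\Omega \nabla u\cdot\nabla\phi\,dx+\int_{\mathbb R^n}\int_{\mathbb R^n}\frac{(u(x)-u(y))(\phi(x)-\phi(y))}{|x-y|^{n+2s}}\,dy\,dx+\int_\Omega c\,u\,\phi\,dx\le\int_\Omega g\,\phi\,dx$$ for every $\phi\in C^1_c(\Omega)$ with $\phi\ge 0$, and that $u\le 0$ on $\partial\Omega$ and $u\le 0$ a.e. in $\mathbb R^n\setminus\Omega$.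 If $|\Omega|\le\delta$, then $$\|u^+\|_{L^\infty(\Omega)}\le\mathcal K\,\|g\|_{L^\infty(\Omega)},\qquad u^+:=\max\{u,0\}.$$ -/

import Mathlib

open MeasureTheory Set
open scoped ENNReal NNReal ContDiff

namespace MixedOp

/-- `Ω` is a bounded Lipschitz domain of `ℝⁿ`: bounded, open, connected (and non-empty), and near
every boundary point `Ω` is, after choosing a unit direction `e`, the part of a ball lying above
the graph of a Lipschitz function of the component orthogonal to `e`. -/
structure IsBoundedLipschitzDomain {n : ℕ} (Ω : Set (EuclideanSpace ℝ (Fin n))) : Prop where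
  isOpen : IsOpen Ω
  isConnected : IsConnected Ω
  isBounded : Bornology.IsBounded Ω
  boundary : ∀ x₀ ∈ frontier Ω, ∃ r > (0 : ℝ), ∃ e : EuclideanSpace ℝ (Fin n), ‖e‖ = 1 ∧
    ∃ (L : ℝ≥0) (γ : EuclideanSpace ℝ (Fin n) → ℝ), LipschitzWith L γ ∧
      ∀ x ∈ Metric.ball x₀ r, x ∈ Ω ↔ γ (x - inner ℝ e x • e) < inner ℝ e x

/-- `u ∈ C¹(Ω̄)`: `u` is continuously differentiable in the open set `Ω`, and `u` and its gradient
are continuous up to the boundary. -/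
def IsC1Closure {n : ℕ} (Ω : Set (EuclideanSpace ℝ (Fin n)))
    (u : EuclideanSpace ℝ (Fin n) → ℝ) : Prop :=
  ContinuousOn u (closure Ω) ∧ ContDiffOn ℝ 1 u Ω ∧
    ∃ G : EuclideanSpace ℝ (Fin n) → EuclideanSpace ℝ (Fin n),
      ContinuousOn G (closure Ω) ∧ ∀ x ∈ Ω, G x = gradient u x

/-- `u ∈ H¹_loc(Ω)` with weak gradient `G`: on every compact subset of `Ω` both `u` and `G` are
square integrable, and `G` is the distributional gradient of `u` in `Ω`. -/
def IsH1LocWithGrad {n : ℕ} (Ω : Set (EuclideanSpace ℝ (Fin n)))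
    (u : EuclideanSpace ℝ (Fin n) → ℝ)
    (G : EuclideanSpace ℝ (Fin n) → EuclideanSpace ℝ (Fin n)) : Prop :=
  (∀ A : Set (EuclideanSpace ℝ (Fin n)), IsCompact A → A ⊆ Ω →
      MemLp u 2 (volume.restrict A) ∧ MemLp G 2 (volume.restrict A)) ∧
  ∀ φ : EuclideanSpace ℝ (Fin n) → ℝ, ContDiff ℝ ∞ φ → HasCompactSupport φ → tsupport φ ⊆ Ω →
    ∀ v : EuclideanSpace ℝ (Fin n),
      ∫ x in Ω, u x * fderiv ℝ φ x v = - ∫ x in Ω, inner ℝ (G x) v * φ x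

/-- The tail space `𝓛ˢ(ℝⁿ)`. -/
def IsTailSpace {n : ℕ} (s : ℝ) (u : EuclideanSpace ℝ (Fin n) → ℝ) : Prop :=
  LocallyIntegrable u volume ∧
    Integrable (fun y => |u y| / (1 + ‖y‖) ^ ((n : ℝ) + 2 * s)) volume

/-- The bilinear form of the fractional Laplacian `(-Δ)ˢ`, without normalising constant:
`∬ (u(x) - u(y)) (φ(x) - φ(y)) / |x - y|^(n + 2s) dy dx`. -/
noncomputable def nonlocalForm {n : ℕ} (s : ℝ) (u φ : EuclideanSpace ℝ (Fin n) → ℝ) : ℝ :=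
  ∫ x, ∫ y, (u x - u y) * (φ x - φ y) / ‖x - y‖ ^ ((n : ℝ) + 2 * s)

/-- `u ∈ H¹_loc(Ω) ∩ 𝓛ˢ(ℝⁿ)` is a weak subsolution of `-Δu + (-Δ)ˢu + c u = g` in `Ω`: the weak
inequality `≤` holds against every non-negative `φ ∈ C¹_c(Ω)`. -/
def IsWeakSubsolution {n : ℕ} (s : ℝ) (Ω : Set (EuclideanSpace ℝ (Fin n)))
    (c g u : EuclideanSpace ℝ (Fin n) → ℝ) : Prop :=
  IsTailSpace s u ∧
  ∃ G : EuclideanSpace ℝ (Fin n) → EuclideanSpace ℝ (Fin n), IsH1LocWithGrad Ω u G ∧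
    ∀ φ : EuclideanSpace ℝ (Fin n) → ℝ, ContDiff ℝ 1 φ → HasCompactSupport φ → tsupport φ ⊆ Ω →
      (∀ x, 0 ≤ φ x) →
      (∫ x in Ω, inner ℝ (G x) (gradient φ x)) + nonlocalForm s u φ + (∫ x in Ω, c x * u x * φ x)
        ≤ ∫ x in Ω, g x * φ x

end MixedOp

/-!
The conclusion holds with `K = 1`. Suppose the maximum `M` of `u` over the closure of `Ω` exceeds
`‖g‖_∞`. For `k > 0` the function `φ = ((u - k)⁺)²` is a `C¹` function with compact support in `Ω`,
because `u ≤ 0` on the boundary, so it can be inserted in the weak formulation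
(`IsWeakSubsolution.energy_le`). The nonlocal term is nonnegative there, since `φ` is almost
everywhere a nondecreasing function of `u` (`nonlocalForm_nonneg_of_monotone`); its size, and with
it the dependence on `s`, plays no role. The weak gradient is the classical one
(`IsH1LocWithGrad.ae_eq_gradient`), and what remains is
`∫ 2 (u - k)⁺ |∇u|² ≤ (1 + Λ) M ∫ φ`.

By Young's inequality this bounds `‖∇φ‖_{L¹}` by a multiple of `M² |{u > k}|`
(`integral_norm_fderiv_truncSq_le`), and Sobolev's inequality for `W^{1,1}` gives
`(h - k)² |{u > h}|^{1 - 1/n} ≤ C M² |{u > k}|` for `h > k` (`superlevel_decay`). Both sides scale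
like `M²`, so De Giorgi's iteration over levels increasing to `M / 2` yields `|{u > M / 2}| = 0` as
soon as `|Ω|` lies below a bound in terms of `n` and `Λ` alone (`exists_measure_bound_le_half`).
This is impossible, as the maximum `M > 0` is attained in `Ω`.
-/

namespace MixedOp

/-! ### Squared truncations -/

lemma hasDerivAt_max_zero_sq (t : ℝ) :
    HasDerivAt (fun t : ℝ => (max t 0) ^ 2) (2 * max t 0) t := by
  rcases lt_trichotomy t 0 with ht | rfl | ht
  · rw [max_eq_right ht.le, mul_zero]
    refine (hasDerivAt_const t (0 : ℝ)).congr_of_eventuallyEq ?_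
    filter_upwards [eventually_lt_nhds ht] with x hx
    simp [max_eq_right hx.le]
  · -- at the kink the function is squeezed between `0` and `t ^ 2`
    simp only [max_self, mul_zero]
    rw [hasDerivAt_iff_isLittleO_nhds_zero]
    have h : (fun t : ℝ => t ^ 2) =o[nhds 0] fun t : ℝ => t :=
      Asymptotics.isLittleO_pow_id one_lt_two
    refine (Asymptotics.IsBigO.of_bound 1 (Filter.Eventually.of_forall fun x => ?_)).trans_isLittleO h
    rcases le_total x 0 with hx | hx
    · simp [max_eq_right hx]
      positivity
    · simp [max_eq_left hx]
  · rw [max_eq_left ht.le]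
    have h := hasDerivAt_pow 2 t
    simp only [Nat.cast_ofNat, Nat.add_one_sub_one, pow_one] at h
    refine h.congr_of_eventuallyEq ?_
    filter_upwards [eventually_gt_nhds ht] with x hx
    simp [max_eq_left hx.le]

lemma contDiff_max_zero_sq : ContDiff ℝ 1 fun t : ℝ => (max t 0) ^ 2 := by
  rw [contDiff_one_iff_deriv]
  refine ⟨fun t => (hasDerivAt_max_zero_sq t).differentiableAt, ?_⟩
  rw [show deriv (fun t : ℝ => (max t 0) ^ 2) = fun t => 2 * max t 0 from
    funext fun t => (hasDerivAt_max_zero_sq t).deriv]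
  fun_prop

lemma monotone_max_zero_sq : Monotone fun t : ℝ => (max t 0) ^ 2 := fun a b h => by
  have : max a 0 ≤ max b 0 := max_le_max_right 0 h
  have : 0 ≤ max a 0 := le_max_right _ _
  dsimp only
  gcongr

/-- The test function `((u - k)⁺)²` in `Ω`, extended by zero. The square makes it `C¹` whenever
`u` is, so that it is admissible in the weak formulation without approximation. -/
noncomputable def truncSq {n : ℕ} (Ω : Set (EuclideanSpace ℝ (Fin n)))
    (u : EuclideanSpace ℝ (Fin n) → ℝ) (k : ℝ) : EuclideanSpace ℝ (Fin n) → ℝ :=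
  Ω.indicator fun x => (max (u x - k) 0) ^ 2

variable {n : ℕ} {Ω : Set (EuclideanSpace ℝ (Fin n))} {u : EuclideanSpace ℝ (Fin n) → ℝ} {k : ℝ}

lemma truncSq_nonneg (x : EuclideanSpace ℝ (Fin n)) : 0 ≤ truncSq Ω u k x :=
  indicator_nonneg (fun _ _ => sq_nonneg _) x

/-- Since `u ≤ 0` on `∂Ω`, the superlevel sets of `u` at positive levels stay away from `∂Ω`. -/
lemma isCompact_superlevel (hb : Bornology.IsBounded Ω) (hcont : ContinuousOn u (closure Ω))
    (ho : IsOpen Ω) (hfr : ∀ x ∈ frontier Ω, u x ≤ 0) (hk : 0 < k) :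
    IsCompact {x ∈ Ω | k ≤ u x} := by
  have h : {x ∈ Ω | k ≤ u x} = closure Ω ∩ u ⁻¹' Ici k := by
    ext x
    refine ⟨fun hx => ⟨subset_closure hx.1, hx.2⟩, fun hx => ⟨?_, hx.2⟩⟩
    by_contra hxΩ
    have hxf : x ∈ frontier Ω := by
      rw [ho.frontier_eq]
      exact ⟨hx.1, hxΩ⟩
    exact absurd (hfr x hxf) (not_le.2 (hk.trans_le hx.2))
  rw [h]
  exact hb.isCompact_closure.of_isClosed_subset
    (hcont.preimage_isClosed_of_isClosed isClosed_closure isClosed_Ici) inter_subset_left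

lemma tsupport_truncSq_subset (hT : IsCompact {x ∈ Ω | k ≤ u x}) :
    tsupport (truncSq Ω u k) ⊆ {x ∈ Ω | k ≤ u x} := by
  refine closure_minimal (fun x hx => ?_) hT.isClosed
  rw [Function.mem_support, truncSq, indicator_apply_ne_zero] at hx
  refine ⟨hx.1, ?_⟩
  by_contra! h
  exact hx.2 (by simp [max_eq_right (sub_nonpos.2 h.le)])

lemma hasCompactSupport_truncSq (hT : IsCompact {x ∈ Ω | k ≤ u x}) :
    HasCompactSupport (truncSq Ω u k) :=
  hT.of_isClosed_subset (isClosed_tsupport _) (tsupport_truncSq_subset hT)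

lemma hasFDerivAt_truncSq (ho : IsOpen Ω) (hu : ContDiffOn ℝ 1 u Ω)
    {x : EuclideanSpace ℝ (Fin n)} (hx : x ∈ Ω) :
    HasFDerivAt (truncSq Ω u k) ((2 * max (u x - k) 0) • fderiv ℝ u x) x := by
  have hux : HasFDerivAt u (fderiv ℝ u x) x :=
    ((hu.differentiableOn one_ne_zero).differentiableAt (ho.mem_nhds hx)).hasFDerivAt
  have h := (hasDerivAt_max_zero_sq (u x - k)).comp_hasFDerivAt x (hux.sub_const k)
  refine h.congr_of_eventuallyEq ?_
  filter_upwards [ho.mem_nhds hx] with y hy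
  simp [truncSq, hy]

lemma contDiff_truncSq (ho : IsOpen Ω) (hu : ContDiffOn ℝ 1 u Ω)
    (hT : IsCompact {x ∈ Ω | k ≤ u x}) : ContDiff ℝ 1 (truncSq Ω u k) := by
  rw [contDiff_iff_contDiffAt]
  intro x
  by_cases hx : x ∈ Ω
  · have h : ContDiffAt ℝ 1 (fun y => (max (u y - k) 0) ^ 2) x :=
      contDiff_max_zero_sq.contDiffAt.comp x
        ((hu.contDiffAt (ho.mem_nhds hx)).sub contDiffAt_const)
    refine h.congr_of_eventuallyEq ?_
    filter_upwards [ho.mem_nhds hx] with y hy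
    simp [truncSq, hy]
  · have hx' : x ∉ tsupport (truncSq Ω u k) := fun h => hx (tsupport_truncSq_subset hT h).1
    exact (contDiffAt_const (c := (0 : ℝ))).congr_of_eventuallyEq
      (notMem_tsupport_iff_eventuallyEq.1 hx')

lemma measurableSet_superlevel (ho : IsOpen Ω) (hu : ContDiffOn ℝ 1 u Ω) :
    MeasurableSet {x ∈ Ω | k < u x} :=
  (hu.continuousOn.isOpen_inter_preimage ho isOpen_Ioi).measurableSet

/-! ### The weak formulation for `C¹` functions -/

/-- The classical gradient of a `C¹` function is its only weak gradient. -/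
lemma IsH1LocWithGrad.ae_eq_gradient {G : EuclideanSpace ℝ (Fin n) → EuclideanSpace ℝ (Fin n)}
    (hG : IsH1LocWithGrad Ω u G) (ho : IsOpen Ω) (hu : ContDiffOn ℝ 1 u Ω) :
    ∀ᵐ x ∂volume.restrict Ω, G x = gradient u x := by
  have hgradc : ContinuousOn (gradient u) Ω :=
    (InnerProductSpace.toDual ℝ _).symm.continuous.comp_continuousOn
      (hu.continuousOn_fderiv_of_isOpen ho le_rfl)
  have hGl : LocallyIntegrableOn G Ω := by
    rw [locallyIntegrableOn_iff ho.isLocallyClosed]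
    intro A hA hAc
    have : IsFiniteMeasure (volume.restrict A) := ⟨by simpa using hAc.measure_lt_top⟩
    exact (hG.1 A hAc hA).2.integrable one_le_two
  have hDl : LocallyIntegrableOn (fun x => G x - gradient u x) Ω :=
    hGl.sub (hgradc.locallyIntegrableOn ho.measurableSet)
  have key : ∀ v : EuclideanSpace ℝ (Fin n),
      ∀ᵐ x ∂(volume : Measure (EuclideanSpace ℝ (Fin n))),
        x ∈ Ω → inner ℝ (G x - gradient u x) v = (0 : ℝ) := by
    intro v
    have hloc : ∀ F : EuclideanSpace ℝ (Fin n) → EuclideanSpace ℝ (Fin n),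
        LocallyIntegrableOn F Ω → LocallyIntegrableOn (fun x => (inner ℝ (F x) v : ℝ)) Ω := by
      intro F hF x hx
      obtain ⟨U, hU, hFU⟩ := hF x hx
      exact ⟨U, hU, hFU.inner_const v⟩
    refine ho.ae_eq_zero_of_integral_contDiff_smul_eq_zero (hloc _ hDl) ?_
    intro φ hφ hφc hφΩ
    have hint : ∀ F : EuclideanSpace ℝ (Fin n) → EuclideanSpace ℝ (Fin n),
        LocallyIntegrableOn F Ω → IntegrableOn (fun x => (inner ℝ (F x) v : ℝ) * φ x) Ω := by
      intro F hF
      have h := ((hloc F hF).integrableOn_compact_subset hφΩ hφc)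
      have h2 : IntegrableOn (fun x => (inner ℝ (F x) v : ℝ) * φ x) (tsupport φ) :=
        h.mul_continuousOn hφ.continuous.continuousOn hφc
      exact (h2.integrable_of_forall_notMem_eq_zero fun x hx => by
        simp [image_eq_zero_of_notMem_tsupport hx]).integrableOn
    -- the product `φ u` is `C¹` on the whole space, so its derivative has integral zero
    have hw : ContDiff ℝ 1 (fun x => φ x * u x) := by
      rw [contDiff_iff_contDiffAt]
      intro x
      by_cases hx : x ∈ Ω
      · exact (hφ.contDiffAt.of_le (by simp)).mul (hu.contDiffAt (ho.mem_nhds hx))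
      · refine (contDiffAt_const (c := (0 : ℝ))).congr_of_eventuallyEq ?_
        filter_upwards [notMem_tsupport_iff_eventuallyEq.1 fun h => hx (hφΩ h)] with y hy
        simp [hy]
    have hwc : HasCompactSupport (fun x => φ x * u x) := hφc.mul_right
    have hwd : HasCompactSupport (fun x => fderiv ℝ (fun x => φ x * u x) x v) :=
      (hwc.fderiv ℝ).comp_left (g := fun L : EuclideanSpace ℝ (Fin n) →L[ℝ] ℝ => L v) rfl
    have hwdc : Continuous (fun x => fderiv ℝ (fun x => φ x * u x) x v) :=
      (hw.continuous_fderiv one_ne_zero).clm_apply continuous_const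
    have h0 : ∫ x, fderiv ℝ (fun x => φ x * u x) x v = 0 := by
      have h := integral_mul_fderiv_eq_neg_fderiv_mul_of_integrable (μ := volume)
        (f := fun x : EuclideanSpace ℝ (Fin n) => φ x * u x)
        (g := fun _ => (1 : ℝ)) (v := v)
        (by simpa using hwdc.integrable_of_hasCompactSupport hwd) (by simp)
        (by simpa using hw.continuous.integrable_of_hasCompactSupport hwc)
        (fun x _ => (hw.differentiable one_ne_zero) x) (fun x _ => by fun_prop)
      simpa using h
    have h1 : ∫ x in Ω, fderiv ℝ (fun x => φ x * u x) x v = 0 := by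
      rw [← h0]
      refine setIntegral_eq_integral_of_forall_compl_eq_zero fun x hx => ?_
      have : x ∉ tsupport (fun x => φ x * u x) :=
        fun h => hx (hφΩ (tsupport_mul_subset_left h))
      rw [fderiv_of_notMem_tsupport (𝕜 := ℝ) this]
      simp
    have h2 : ∀ x ∈ Ω, fderiv ℝ (fun x => φ x * u x) x v
        = u x * fderiv ℝ φ x v + inner ℝ (gradient u x) v * φ x := by
      intro x hx
      have hux := (hu.differentiableOn one_ne_zero).differentiableAt (ho.mem_nhds hx)
      have hφx := (hφ.differentiable (by simp)) x
      rw [fderiv_fun_mul hφx hux]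
      have : (inner ℝ (gradient u x) v : ℝ) = fderiv ℝ u x v := by
        simp [gradient]
      simp [this]
      ring
    have hgi := hint _ (hgradc.locallyIntegrableOn ho.measurableSet)
    have hui : IntegrableOn (fun x => u x * fderiv ℝ φ x v) Ω := by
      have h := ((hwdc.integrable_of_hasCompactSupport hwd).integrableOn (s := Ω)).sub hgi
      refine h.congr_fun (fun x hx => ?_) ho.measurableSet
      simp [h2 x hx]
    rw [setIntegral_congr_fun ho.measurableSet h2, integral_add hui hgi,
      hG.2 φ hφ hφc hφΩ v] at h1
    have h3 : ∫ x, φ x • (inner ℝ (G x - gradient u x) v : ℝ)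
        = ∫ x in Ω, ((inner ℝ (G x) v : ℝ) * φ x - inner ℝ (gradient u x) v * φ x) := by
      rw [← setIntegral_eq_integral_of_forall_compl_eq_zero (s := Ω)]
      · refine setIntegral_congr_fun ho.measurableSet fun x _ => ?_
        simp only [inner_sub_left, smul_eq_mul]
        ring
      · intro x hx
        simp [image_eq_zero_of_notMem_tsupport fun h => hx (hφΩ h)]
    rw [h3, integral_sub (hint _ hGl) hgi]
    linarith
  rw [ae_restrict_iff' ho.measurableSet]
  have := ae_all_iff.2 fun i => key (EuclideanSpace.basisFun (Fin n) ℝ i)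
  filter_upwards [this] with x hx hxΩ
  rw [← sub_eq_zero]
  ext i
  simpa [PiLp.inner_apply] using hx i hxΩ

/-- The nonlocal form is nonnegative on `u` and a nondecreasing function of `u`: its integrand is
so pointwise, whence no integrability is needed. -/
lemma nonlocalForm_nonneg_of_monotone {s : ℝ} {φ : EuclideanSpace ℝ (Fin n) → ℝ} {ψ : ℝ → ℝ}
    (hψ : Monotone ψ) (hφ : ∀ᵐ x ∂(volume : Measure (EuclideanSpace ℝ (Fin n))), φ x = ψ (u x)) :
    0 ≤ nonlocalForm s u φ := by
  refine integral_nonneg_of_ae ?_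
  filter_upwards [hφ] with x hx
  refine integral_nonneg_of_ae ?_
  filter_upwards [hφ] with y hy
  rw [hx, hy]
  refine div_nonneg ?_ (by positivity)
  rcases le_total (u x) (u y) with h | h
  · exact mul_nonneg_of_nonpos_of_nonpos (sub_nonpos.2 h) (sub_nonpos.2 (hψ h))
  · exact mul_nonneg (sub_nonneg.2 h) (sub_nonneg.2 (hψ h))

lemma truncSq_ae_eq (ho : IsOpen Ω) (hout : ∀ᵐ x ∂(volume.restrict Ωᶜ), u x ≤ 0) (hk : 0 < k) :
    ∀ᵐ x ∂(volume : Measure (EuclideanSpace ℝ (Fin n))),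
      truncSq Ω u k x = (fun t : ℝ => (max (t - k) 0) ^ 2) (u x) := by
  rw [ae_restrict_iff' ho.measurableSet.compl] at hout
  filter_upwards [hout] with x hx
  by_cases hxΩ : x ∈ Ω
  · simp [truncSq, hxΩ]
  · have := hx hxΩ
    simp [truncSq, hxΩ, max_eq_right (show u x - k ≤ 0 by linarith)]

/-! ### Decay of the superlevel sets -/

lemma truncSq_le_indicator {M : ℝ} (hk : 0 < k) (hle : ∀ x ∈ Ω, u x ≤ M)
    (x : EuclideanSpace ℝ (Fin n)) :
    truncSq Ω u k x ≤ {x ∈ Ω | k < u x}.indicator (fun _ => M ^ 2) x := by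
  by_cases hx : x ∈ {x ∈ Ω | k < u x}
  · rw [indicator_of_mem hx, truncSq, indicator_of_mem hx.1]
    have h1 := hle x hx.1
    have h2 := hx.2
    rw [max_eq_left (by linarith)]
    exact pow_le_pow_left₀ (by linarith) (by linarith) 2
  · rw [indicator_of_notMem hx, truncSq]
    by_cases hxΩ : x ∈ Ω
    · have : u x ≤ k := by
        by_contra! h
        exact hx ⟨hxΩ, h⟩
      simp [hxΩ, max_eq_right (sub_nonpos.2 this)]
    · simp [hxΩ]

lemma setIntegral_truncSq_le {M : ℝ} (ho : IsOpen Ω) (hu : ContDiffOn ℝ 1 u Ω)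
    (hk : 0 < k) (hle : ∀ x ∈ Ω, u x ≤ M) (hfin : volume Ω ≠ ⊤) :
    ∫ x in Ω, truncSq Ω u k x ≤ M ^ 2 * volume.real {x ∈ Ω | k < u x} := by
  have hA := measurableSet_superlevel (k := k) ho hu
  have hAfin : volume {x ∈ Ω | k < u x} ≠ ⊤ := measure_ne_top_of_subset (sep_subset _ _) hfin
  calc ∫ x in Ω, truncSq Ω u k x
      ≤ ∫ x in Ω, {x ∈ Ω | k < u x}.indicator (fun _ => M ^ 2) x :=
        integral_mono_of_nonneg (Filter.Eventually.of_forall truncSq_nonneg)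
          ((integrable_indicator_iff hA).2 (integrableOn_const hAfin)).integrableOn
          (Filter.Eventually.of_forall (truncSq_le_indicator hk hle))
    _ = M ^ 2 * volume.real {x ∈ Ω | k < u x} := by
        rw [setIntegral_indicator hA, inter_eq_self_of_subset_right (sep_subset _ _),
          setIntegral_const, smul_eq_mul, mul_comm]

lemma gradient_truncSq (ho : IsOpen Ω) (hu : ContDiffOn ℝ 1 u Ω)
    {x : EuclideanSpace ℝ (Fin n)} (hx : x ∈ Ω) :
    gradient (truncSq Ω u k) x = (2 * max (u x - k) 0) • gradient u x := by
  simp [gradient, (hasFDerivAt_truncSq (k := k) ho hu hx).fderiv]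

/-- The energy inequality obtained by testing with `((u - k)⁺)²` bounds the `L¹` norm of the
gradient of that test function. By Young's inequality `2 |∇u| ≤ |∇u|² / M + M`, no Cauchy–Schwarz
inequality is needed. -/
lemma integral_norm_fderiv_truncSq_le {M L : ℝ} (ho : IsOpen Ω) (hu : ContDiffOn ℝ 1 u Ω)
    (hT : IsCompact {x ∈ Ω | k ≤ u x}) (hk : 0 < k) (hM : 0 < M) (hL : 0 ≤ L)
    (hle : ∀ x ∈ Ω, u x ≤ M) (hfin : volume Ω ≠ ⊤)
    (henergy : ∫ x in Ω, inner ℝ (gradient u x) (gradient (truncSq Ω u k) x)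
      ≤ L * M * ∫ x in Ω, truncSq Ω u k x) :
    ∫ x, ‖fderiv ℝ (truncSq Ω u k) x‖
      ≤ (L / 2 + 1) * M ^ 2 * volume.real {x ∈ Ω | k < u x} := by
  have hA := measurableSet_superlevel (k := k) ho hu
  have hAfin : volume {x ∈ Ω | k < u x} ≠ ⊤ := measure_ne_top_of_subset (sep_subset _ _) hfin
  have hC := contDiff_truncSq ho hu hT
  have hgradc : ContinuousOn (gradient u) Ω :=
    (InnerProductSpace.toDual ℝ _).symm.continuous.comp_continuousOn
      (hu.continuousOn_fderiv_of_isOpen ho le_rfl)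
  have hgradφ : Continuous (gradient (truncSq Ω u k)) :=
    (InnerProductSpace.toDual ℝ _).symm.continuous.comp (hC.continuous_fderiv one_ne_zero)
  have hzero : ∀ x ∉ {x ∈ Ω | k ≤ u x}, fderiv ℝ (truncSq Ω u k) x = 0 := fun x hx =>
    fderiv_of_notMem_tsupport ℝ (fun h => hx (tsupport_truncSq_subset hT h))
  have hI : Integrable fun x => (inner ℝ (gradient u x) (gradient (truncSq Ω u k) x) : ℝ) := by
    have h : IntegrableOn (fun x => (inner ℝ (gradient u x) (gradient (truncSq Ω u k) x) : ℝ))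
        {x ∈ Ω | k ≤ u x} :=
      ((hgradc.mono (sep_subset _ _)).inner hgradφ.continuousOn).integrableOn_compact hT
    refine h.integrable_of_forall_notMem_eq_zero fun x hx => ?_
    simp [gradient, hzero x hx]
  have hind : IntegrableOn ({x ∈ Ω | k < u x}.indicator fun _ => M ^ 2) Ω :=
    ((integrable_indicator_iff hA).2 (integrableOn_const hAfin)).integrableOn
  have hpt : ∀ x ∈ Ω, ‖fderiv ℝ (truncSq Ω u k) x‖
      ≤ (2 * M)⁻¹ * inner ℝ (gradient u x) (gradient (truncSq Ω u k) x)
        + {x ∈ Ω | k < u x}.indicator (fun _ => M ^ 2) x := by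
    intro x hx
    have hn : ‖gradient u x‖ = ‖fderiv ℝ u x‖ := by simp [gradient]
    rw [gradient_truncSq ho hu hx, (hasFDerivAt_truncSq ho hu hx).fderiv, real_inner_smul_right,
      real_inner_self_eq_norm_sq, hn, norm_smul, Real.norm_of_nonneg (by positivity)]
    generalize ‖fderiv ℝ u x‖ = d
    by_cases hxk : k < u x
    · have h1 := hle x hx
      rw [indicator_of_mem (show x ∈ {x ∈ Ω | k < u x} from ⟨hx, hxk⟩),
        max_eq_left (by linarith)]
      have hq : 0 ≤ u x - k := by linarith
      have hqM : u x - k ≤ M := by linarith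
      generalize u x - k = q at hq hqM
      have h2 : 2 * d ≤ M⁻¹ * d ^ 2 + M := by
        have : M⁻¹ * d ^ 2 + M - 2 * d = M⁻¹ * (d - M) ^ 2 := by
          field_simp
          ring
        have : 0 ≤ M⁻¹ * (d - M) ^ 2 := by positivity
        linarith
      calc 2 * q * d = q * (2 * d) := by ring
        _ ≤ q * (M⁻¹ * d ^ 2 + M) := by gcongr
        _ = (2 * M)⁻¹ * (2 * q * d ^ 2) + q * M := by
            field_simp
        _ ≤ (2 * M)⁻¹ * (2 * q * d ^ 2) + M ^ 2 := by nlinarith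
    · rw [indicator_of_notMem fun h => hxk h.2, max_eq_right (by linarith)]
      simp
  calc ∫ x, ‖fderiv ℝ (truncSq Ω u k) x‖
      = ∫ x in Ω, ‖fderiv ℝ (truncSq Ω u k) x‖ :=
        (setIntegral_eq_integral_of_forall_compl_eq_zero fun x hx => by
          rw [hzero x fun h => hx h.1, norm_zero]).symm
    _ ≤ ∫ x in Ω, ((2 * M)⁻¹ * inner ℝ (gradient u x) (gradient (truncSq Ω u k) x)
          + {x ∈ Ω | k < u x}.indicator (fun _ => M ^ 2) x) :=
        setIntegral_mono_on
          (((hC.continuous_fderiv one_ne_zero).norm.integrable_of_hasCompactSupport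
            ((hasCompactSupport_truncSq hT).fderiv ℝ).norm).integrableOn)
          ((hI.integrableOn.const_mul _).add hind) ho.measurableSet hpt
    _ = (2 * M)⁻¹ * (∫ x in Ω, inner ℝ (gradient u x) (gradient (truncSq Ω u k) x))
          + M ^ 2 * volume.real {x ∈ Ω | k < u x} := by
        rw [integral_add (hI.integrableOn.const_mul _) hind, integral_const_mul,
          setIntegral_indicator hA, inter_eq_self_of_subset_right (sep_subset _ _),
          setIntegral_const, smul_eq_mul, mul_comm (M ^ 2)]
    _ ≤ (2 * M)⁻¹ * (L * M * (M ^ 2 * volume.real {x ∈ Ω | k < u x}))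
          + M ^ 2 * volume.real {x ∈ Ω | k < u x} := by
        gcongr
        refine henergy.trans ?_
        gcongr
        exact setIntegral_truncSq_le ho hu hk hle hfin
    _ = (L / 2 + 1) * M ^ 2 * volume.real {x ∈ Ω | k < u x} := by
        field_simp

/-- The constant in the Sobolev inequality `W^{1,1}(ℝⁿ) ⊆ L^p(ℝⁿ)`, `p = n / (n - 1)`. -/
noncomputable def sobolevConst (n : ℕ) (p : ℝ≥0) : ℝ≥0 :=
  eLpNormLESNormFDerivOneConst (volume : Measure (EuclideanSpace ℝ (Fin n))) p

/-- Sobolev's inequality for `((u - k)⁺)²` together with Markov's inequality at the level `h`. -/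
lemma superlevel_decay {p : ℝ≥0} (hp : NNReal.HolderConjugate (n : ℝ≥0) p) {h D : ℝ}
    (ho : IsOpen Ω) (hu : ContDiffOn ℝ 1 u Ω) (hT : IsCompact {x ∈ Ω | k ≤ u x})
    (hkh : k < h) (hD : ∫ x, ‖fderiv ℝ (truncSq Ω u k) x‖ ≤ D) :
    ((h - k) ^ 2) ^ (p : ℝ) * volume.real {x ∈ Ω | h < u x}
      ≤ (sobolevConst n p * D) ^ (p : ℝ) := by
  have hp0 : p ≠ 0 := hp.symm.pos.ne'
  have hC := contDiff_truncSq ho hu hT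
  have hcs := hasCompactSupport_truncSq hT
  have hD0 : 0 ≤ D := (integral_nonneg fun _ => norm_nonneg _).trans hD
  have hsob : eLpNorm (truncSq Ω u k) p volume
      ≤ ENNReal.ofReal (sobolevConst n p * D) := by
    refine (eLpNorm_le_eLpNorm_fderiv_one (μ := volume) hC hcs (p := p) (by simpa using hp)).trans ?_
    rw [eLpNorm_one_eq_lintegral_enorm, ENNReal.ofReal_mul (by positivity),
      ENNReal.ofReal_coe_nnreal]
    gcongr
    · exact le_rfl
    · rw [← ofReal_integral_norm_eq_lintegral_enorm
        ((hC.continuous_fderiv one_ne_zero).integrable_of_hasCompactSupport (hcs.fderiv ℝ))]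
      exact ENNReal.ofReal_le_ofReal hD
  have hmarkov := mul_meas_ge_le_pow_eLpNorm' (μ := volume) (p := (p : ℝ≥0∞)) (by simpa using hp0)
    ENNReal.coe_ne_top hC.continuous.aestronglyMeasurable (ENNReal.ofReal ((h - k) ^ 2))
  rw [ENNReal.coe_toReal] at hmarkov
  have hsub : {x ∈ Ω | h < u x} ⊆ {x | ENNReal.ofReal ((h - k) ^ 2) ≤ ‖truncSq Ω u k x‖ₑ} := by
    intro x hx
    have h1 := hx.2
    rw [mem_ofPred_eq, Real.enorm_of_nonneg (truncSq_nonneg x), truncSq, indicator_of_mem hx.1,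
      max_eq_left (by linarith)]
    exact ENNReal.ofReal_le_ofReal (pow_le_pow_left₀ (by linarith) (by linarith) 2)
  have hfinal : ENNReal.ofReal ((h - k) ^ 2) ^ (p : ℝ) * volume {x ∈ Ω | h < u x}
      ≤ ENNReal.ofReal (sobolevConst n p * D) ^ (p : ℝ) :=
    (mul_le_mul_right (measure_mono hsub) _).trans
      (hmarkov.trans (ENNReal.rpow_le_rpow hsob p.2))
  have := ENNReal.toReal_mono (by finiteness) hfinal
  rwa [ENNReal.toReal_mul, ← ENNReal.toReal_rpow, ← ENNReal.toReal_rpow,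
    ENNReal.toReal_ofReal (by positivity), ENNReal.toReal_ofReal (by positivity)] at this

/-! ### De Giorgi iteration -/

/-- De Giorgi's fast convergence lemma: a sequence with superlinear recursion tends to zero if it
starts small enough. -/
lemma exists_pos_tendsto_zero_of_recursion {p B : ℝ} (hp : 1 < p) (hB : 0 < B) :
    ∃ ε > 0, ∀ a : ℕ → ℝ, (∀ j, 0 ≤ a j) → a 0 ≤ ε →
      (∀ j, a (j + 1) ≤ (B * 4 ^ j * a j) ^ p) → Filter.Tendsto a Filter.atTop (nhds 0) := by
  have hp1 : 0 < p - 1 := sub_pos.2 hp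
  -- `θ` and `ε` solve `(4 θ) ^ p = θ` and `(B ε) ^ p = ε θ`, so that `ε θ ^ j` is a supersolution
  set θ : ℝ := 4 ^ (-(p / (p - 1))) with hθ
  have hθ0 : 0 < θ := by positivity
  have hθ1 : θ < 1 := Real.rpow_lt_one_of_one_lt_of_neg (by norm_num)
    (neg_lt_zero.2 (div_pos (by linarith) hp1))
  have hθp : (4 * θ) ^ p = θ := by
    have : 4 * θ = 4 ^ (1 + -(p / (p - 1))) := by
      rw [hθ, Real.rpow_add (by norm_num), Real.rpow_one]
    rw [this, ← Real.rpow_mul (by norm_num), hθ]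
    congr 1
    field_simp
    ring
  set ε : ℝ := (θ * (B ^ p)⁻¹) ^ (p - 1)⁻¹ with hε
  have hBp : 0 < B ^ p := by positivity
  have hε0 : 0 < ε := by positivity
  have hεp : (B * ε) ^ p = ε * θ := by
    have h1 : ε ^ (p - 1) = θ * (B ^ p)⁻¹ := by
      rw [hε, ← Real.rpow_mul (by positivity), inv_mul_cancel₀ hp1.ne', Real.rpow_one]
    have h2 : ε ^ p = ε ^ (p - 1) * ε := by
      rw [← Real.rpow_add_one hε0.ne', sub_add_cancel]
    rw [Real.mul_rpow hB.le hε0.le, h2, h1]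
    field_simp
  refine ⟨ε, hε0, fun a ha ha0 hrec => ?_⟩
  have hbound : ∀ j, a j ≤ ε * θ ^ j := by
    intro j
    induction j with
    | zero => simpa using ha0
    | succ j ih =>
      calc a (j + 1) ≤ (B * 4 ^ j * a j) ^ p := hrec j
        _ ≤ (B * 4 ^ j * (ε * θ ^ j)) ^ p :=
          Real.rpow_le_rpow (mul_nonneg (by positivity) (ha j)) (by gcongr) (by linarith)
        _ = (B * ε * (4 * θ) ^ j) ^ p := by
          rw [mul_pow]
          ring_nf
        _ = ε * θ * θ ^ j := by
          rw [Real.mul_rpow (by positivity) (by positivity), hεp, ← Real.rpow_natCast,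
            ← Real.rpow_mul (by positivity), mul_comm (j : ℝ), Real.rpow_mul (by positivity), hθp,
            Real.rpow_natCast]
        _ = ε * θ ^ (j + 1) := by ring
  refine squeeze_zero ha hbound ?_
  simpa using (tendsto_pow_atTop_nhds_zero_of_lt_one hθ0.le hθ1).const_mul ε

/-- A bounded function whose squared truncations satisfy the energy inequality at all levels
stays below half its bound if its domain has small measure. The smallness depends only on the
dimension and on the constant in the energy inequality. -/
lemma exists_measure_bound_le_half (hn : 2 ≤ n) {L : ℝ} (hL : 0 ≤ L) :
    ∃ δ : ℝ≥0, 0 < δ ∧ ∀ (Ω : Set (EuclideanSpace ℝ (Fin n)))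
      (u : EuclideanSpace ℝ (Fin n) → ℝ) (M : ℝ), IsOpen Ω → ContDiffOn ℝ 1 u Ω → 0 < M →
      (∀ k, 0 < k → IsCompact {x ∈ Ω | k ≤ u x}) → (∀ x ∈ Ω, u x ≤ M) → volume Ω ≤ δ →
      (∀ k, 0 < k → ∫ x in Ω, inner ℝ (gradient u x) (gradient (truncSq Ω u k) x)
        ≤ L * M * ∫ x in Ω, truncSq Ω u k x) →
      ∀ x ∈ Ω, u x ≤ M / 2 := by
  obtain ⟨p, hp⟩ : ∃ p : ℝ≥0, NNReal.HolderConjugate (n : ℝ≥0) p :=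
    ⟨_, NNReal.HolderConjugate.conjExponent (by exact_mod_cast hn)⟩
  have hp1 : 1 < (p : ℝ) := by exact_mod_cast hp.symm.lt
  set C : ℝ := sobolevConst n p * (L / 2 + 1) with hCdef
  have hC : 0 ≤ C := by positivity
  obtain ⟨ε, hε, hconv⟩ := exists_pos_tendsto_zero_of_recursion hp1
    (show 0 < 64 * C + 1 by positivity)
  refine ⟨ε.toNNReal, Real.toNNReal_pos.2 hε, ?_⟩
  intro Ω u M ho hu hM hT hle hvol henergy x hx
  have hfin : volume Ω ≠ ⊤ := (hvol.trans_lt ENNReal.coe_lt_top).ne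
  -- the levels increase from `M / 4` to `M / 2`, with gaps `M / (8 * 2 ^ j)`
  set l : ℕ → ℝ := fun j => M * (1 / 2 - 1 / (4 * 2 ^ j)) with hl
  have hl0 : ∀ j, 0 < l j := by
    intro j
    have h1 : (1 : ℝ) ≤ 2 ^ j := one_le_pow₀ (by norm_num)
    have : 1 / (4 * 2 ^ j) ≤ (1 : ℝ) / 4 := by
      apply one_div_le_one_div_of_le <;> linarith
    exact mul_pos hM (by linarith)
  have hlM : ∀ j, l j < M / 2 := by
    intro j
    have : (0 : ℝ) < 1 / (4 * 2 ^ j) := by positivity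
    simp only [hl]
    nlinarith
  have hgap : ∀ j, (l (j + 1) - l j) ^ 2 = M ^ 2 / (64 * 4 ^ j) := by
    intro j
    have h4 : (4 : ℝ) ^ j = 2 ^ j * 2 ^ j := by rw [← mul_pow]; norm_num
    simp only [hl, h4, pow_succ]
    field_simp
    ring
  have hlt : ∀ j, l j < l (j + 1) := by
    intro j
    have : (1 : ℝ) / (4 * 2 ^ (j + 1)) < 1 / (4 * 2 ^ j) := by
      apply one_div_lt_one_div_of_lt (by positivity)
      rw [pow_succ]
      have : (0 : ℝ) < 2 ^ j := by positivity
      linarith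
    simp only [hl]
    gcongr
  set a : ℕ → ℝ := fun j => volume.real {x ∈ Ω | l j < u x} with ha
  have ha0 : ∀ j, 0 ≤ a j := fun j => measureReal_nonneg
  have hrec : ∀ j, a (j + 1) ≤ ((64 * C + 1) * 4 ^ j * a j) ^ (p : ℝ) := by
    intro j
    have hd := integral_norm_fderiv_truncSq_le ho hu (hT _ (hl0 j)) (hl0 j) hM hL hle hfin
      (henergy _ (hl0 j))
    have h := superlevel_decay hp ho hu (hT _ (hl0 j)) (hlt j) hd
    rw [hgap] at h
    have hpos : 0 < (M ^ 2 / (64 * 4 ^ j)) ^ (p : ℝ) := by positivity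
    have hX : 0 ≤ sobolevConst n p * ((L / 2 + 1) * M ^ 2 * a j) :=
      mul_nonneg (by positivity) (mul_nonneg (by positivity) (ha0 j))
    rw [mul_comm, ← le_div_iff₀ hpos, ← Real.div_rpow hX (by positivity)] at h
    refine h.trans (Real.rpow_le_rpow (div_nonneg hX (by positivity)) ?_ p.2)
    calc sobolevConst n p * ((L / 2 + 1) * M ^ 2 * a j) / (M ^ 2 / (64 * 4 ^ j))
        = 64 * C * 4 ^ j * a j := by
          rw [hCdef]
          field_simp
      _ ≤ (64 * C + 1) * 4 ^ j * a j := by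
          have := ha0 j
          gcongr
          linarith
  have hstart : a 0 ≤ ε := by
    refine ENNReal.toReal_le_of_le_ofReal hε.le ?_
    exact (measure_mono (sep_subset _ _)).trans hvol
  have hlim := hconv a ha0 hstart hrec
  have hle0 : volume.real {x ∈ Ω | M / 2 < u x} ≤ 0 :=
    ge_of_tendsto' hlim fun j => measureReal_mono
      (fun y hy => ⟨hy.1, (hlM j).trans hy.2⟩) (measure_ne_top_of_subset (sep_subset _ _) hfin)
  by_contra! hcon
  -- a null open set is empty
  have hopen : IsOpen {x ∈ Ω | M / 2 < u x} :=
    hu.continuousOn.isOpen_inter_preimage ho isOpen_Ioi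
  have hpos := hopen.measure_pos volume ⟨x, hx, hcon⟩
  exact absurd hle0 (not_le.2 (ENNReal.toReal_pos hpos.ne'
    (measure_ne_top_of_subset (sep_subset _ _) hfin)))

/-- Testing the subsolution property with `((u - k)⁺)²`: the nonlocal form has the good sign, and
the lower order terms are controlled by the bounds of `c`, `g` and `u`. -/
lemma IsWeakSubsolution.energy_le {s M Λ : ℝ} {c g : EuclideanSpace ℝ (Fin n) → ℝ}
    (hsub : IsWeakSubsolution s Ω c g u) (ho : IsOpen Ω) (hu : ContDiffOn ℝ 1 u Ω)
    (hT : IsCompact {x ∈ Ω | k ≤ u x}) (hk : 0 < k)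
    (hout : ∀ᵐ x ∂(volume.restrict Ωᶜ), u x ≤ 0) (hle : ∀ x ∈ Ω, u x ≤ M)
    (hc : ∀ᵐ x ∂(volume.restrict Ω), |c x| ≤ Λ) (hg : ∀ᵐ x ∂(volume.restrict Ω), |g x| ≤ M) :
    ∫ x in Ω, inner ℝ (gradient u x) (gradient (truncSq Ω u k) x)
      ≤ (1 + Λ) * M * ∫ x in Ω, truncSq Ω u k x := by
  obtain ⟨-, G, hG, htest⟩ := hsub
  have hC := contDiff_truncSq ho hu hT
  have hcs := hasCompactSupport_truncSq hT
  have h := htest _ hC hcs ((tsupport_truncSq_subset hT).trans (sep_subset _ _)) truncSq_nonneg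
  have hmono : Monotone fun t : ℝ => (max (t - k) 0) ^ 2 := fun a b hab =>
    monotone_max_zero_sq (sub_le_sub_right hab k)
  have hnl : 0 ≤ nonlocalForm s u (truncSq Ω u k) :=
    nonlocalForm_nonneg_of_monotone hmono (truncSq_ae_eq ho hout hk)
  have hgrad : ∫ x in Ω, inner ℝ (G x) (gradient (truncSq Ω u k) x)
      = ∫ x in Ω, inner ℝ (gradient u x) (gradient (truncSq Ω u k) x) := by
    refine integral_congr_ae ?_
    filter_upwards [hG.ae_eq_gradient ho hu] with x hx
    rw [hx]
  have hφ : IntegrableOn (truncSq Ω u k) Ω :=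
    (hC.continuous.integrable_of_hasCompactSupport hcs).integrableOn
  have hgb : |∫ x in Ω, g x * truncSq Ω u k x| ≤ ∫ x in Ω, M * truncSq Ω u k x := by
    rw [← Real.norm_eq_abs]
    refine norm_integral_le_of_norm_le (hφ.const_mul M) ?_
    filter_upwards [hg] with x hx
    rw [norm_mul, Real.norm_of_nonneg (truncSq_nonneg x)]
    exact mul_le_mul_of_nonneg_right hx (truncSq_nonneg x)
  have hcb : |∫ x in Ω, c x * u x * truncSq Ω u k x| ≤ ∫ x in Ω, Λ * M * truncSq Ω u k x := by
    rw [← Real.norm_eq_abs]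
    refine norm_integral_le_of_norm_le (hφ.const_mul (Λ * M)) ?_
    filter_upwards [hc, ae_restrict_mem ho.measurableSet] with x hx hxΩ
    by_cases hxk : k ≤ u x
    · rw [norm_mul, norm_mul, Real.norm_of_nonneg (truncSq_nonneg x),
        Real.norm_of_nonneg (hk.le.trans hxk)]
      refine mul_le_mul_of_nonneg_right ?_ (truncSq_nonneg x)
      exact mul_le_mul hx (hle x hxΩ) (hk.le.trans hxk) ((abs_nonneg _).trans hx)
    · -- where `u < k` the test function vanishes, so no lower bound of `u` is needed
      simp [truncSq, hxΩ, max_eq_right (show u x - k ≤ 0 by linarith)]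
  rw [integral_const_mul] at hgb hcb
  have h1 := (abs_le.1 hgb).2
  have h2 := (abs_le.1 hcb).1
  rw [hgrad] at h
  linarith

end MixedOp

theorem lemma2p7 (n : ℕ) (hn : 2 ≤ n) (Λ : ℝ≥0) :
    ∃ δ : ℝ≥0, 0 < δ ∧ ∃ K : ℝ≥0, 0 < K ∧
      ∀ (s : ℝ), 0 < s → s < 1 →
      ∀ (Ω : Set (EuclideanSpace ℝ (Fin n))), MixedOp.IsBoundedLipschitzDomain Ω →
      ∀ (c g u : EuclideanSpace ℝ (Fin n) → ℝ),
        MemLp c ∞ (volume.restrict Ω) →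
        MemLp g ∞ (volume.restrict Ω) →
        eLpNorm c ∞ (volume.restrict Ω) ≤ (Λ : ℝ≥0∞) →
        MixedOp.IsC1Closure Ω u →
        MixedOp.IsWeakSubsolution s Ω c g u →
        (∀ x ∈ frontier Ω, u x ≤ 0) →
        (∀ᵐ x ∂(volume.restrict Ωᶜ), u x ≤ 0) →
        volume Ω ≤ (δ : ℝ≥0∞) →
        eLpNorm (fun x => max (u x) 0) ∞ (volume.restrict Ω)
          ≤ (K : ℝ≥0∞) * eLpNorm g ∞ (volume.restrict Ω) := by
  obtain ⟨δ, hδ, hhalf⟩ := MixedOp.exists_measure_bound_le_half hn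
    (L := 1 + (Λ : ℝ)) (by positivity)
  refine ⟨δ, hδ, 1, one_pos, ?_⟩
  intro s _ _ Ω hΩ c g u _ hg hcΛ hu hsub hfr hout hvol
  have ho := hΩ.isOpen
  obtain ⟨x₀, hx₀, hmax⟩ := hΩ.isBounded.isCompact_closure.exists_isMaxOn
    hΩ.isConnected.nonempty.closure hu.1
  have hle : ∀ x ∈ Ω, u x ≤ u x₀ := fun x hx => hmax (subset_closure hx)
  have hae : ∀ {f : EuclideanSpace ℝ (Fin n) → ℝ} {b : ℝ≥0},
      eLpNorm f ∞ (volume.restrict Ω) ≤ b → ∀ᵐ x ∂(volume.restrict Ω), |f x| ≤ b := by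
    intro f b hfb
    rw [eLpNorm_exponent_top] at hfb
    filter_upwards [enorm_ae_le_eLpNormEssSup f (volume.restrict Ω)] with x hx
    have h := hx.trans hfb
    rw [enorm_le_coe] at h
    exact_mod_cast h
  lift eLpNorm g ∞ (volume.restrict Ω) to ℝ≥0 using hg.2.ne with b hb
  have hgb := hae hb.ge
  rw [ENNReal.coe_one, one_mul]
  by_cases hM : u x₀ ≤ b
  · rw [eLpNorm_exponent_top]
    refine eLpNormEssSup_le_of_ae_enorm_bound ?_
    filter_upwards [ae_restrict_mem ho.measurableSet] with x hx
    rw [enorm_le_coe, ← NNReal.coe_le_coe, coe_nnnorm, Real.norm_of_nonneg (le_max_right _ _)]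
    exact max_le ((hle x hx).trans hM) b.2
  · exfalso
    push Not at hM
    have hM0 : 0 < u x₀ := b.2.trans_lt hM
    have hx₀Ω : x₀ ∈ Ω := by
      by_contra h
      have : x₀ ∈ frontier Ω := by
        rw [ho.frontier_eq]
        exact ⟨hx₀, h⟩
      exact absurd (hfr x₀ this) (not_le.2 hM0)
    have hT : ∀ k, 0 < k → IsCompact {x ∈ Ω | k ≤ u x} := fun k hk =>
      MixedOp.isCompact_superlevel hΩ.isBounded hu.1 ho hfr hk
    have := hhalf Ω u (u x₀) ho hu.2.1 hM0 hT hle hvol (fun k hk =>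
      hsub.energy_le ho hu.2.1 (hT k hk) hk hout hle (hae hcΛ)
        (hgb.mono fun x hx => hx.trans hM.le)) x₀ hx₀Ω
    linarith
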